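/- Let $N_1,N_2\ge 1$. Qubits live on a torus: a white qubit at each $(n,j)$ and a black qubit at each $(n+\tfrac12,j+\tfrac12)$, with $n\in\mathbb Z/N_2$, $j\in\mathbb Z/N_1$. Write $w_{a,b}$ for the white qubit at $(n+a,j+b)$ and $g_{a,b}$ for the black qubit at $(n+a+\tfrac12,j+b+\tfrac12)$. Let $X,Z$ be the Pauli matrices, $S=\mathrm{diag}(1,i)$ and $\mathrm{CZ}$ the controlled-$Z$ gate. Put $A_{n+1/2,j}=X_{w_{0,0}}X_{w_{1,0}}X_{g_{0,-1}}X_{g_{0,0}}$. The stabilizers of the double-semion bulk model are $$S^M_{n,j+1/2}=Z_{w_{0,0}}Z_{w_{0,1}}Z_{g_{-1,0}}Z_{g_{0,0}},$$ $$S^E_{n+1/2,j}=-A_{n+1/2,j}\;\Big(\prod_{s}S^\dagger_s\Big)\,Z_{w_{0,1}}Z_{w_{1,-1}}\prod_{\{s,t\}}\mathrm{CZ}_{s,t},$$ where $s$ runs over $w_{0,-1},w_{0,0},w_{1,0},w_{1,1},g_{0,-1},g_{0,0}$ and $\{s,t\}$ runs over the 22 pairs: the 8 pairs $w_{0,0}w_{0,1}$,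 $w_{1,-1}w_{1,0}$, $w_{0,-1}w_{1,-1}$, $w_{0,1}w_{1,1}$, $w_{0,-1}w_{1,0}$, $w_{0,0}w_{1,1}$, $w_{0,0}w_{1,-1}$, $w_{0,1}w_{1,0}$; the pairs of $g_{1,-1}$ with each of $w_{0,-1},w_{0,0},w_{1,-1},w_{1,0},w_{2,-1},w_{2,0},g_{2,-1}$; and the pairs of $g_{1,0}$ with each of $w_{0,0},w_{0,1},w_{1,0},w_{1,1},w_{2,0},w_{2,1},g_{2,0}$. The reduced stabilizers, which agree with $S^E$ on the subspace where all $S^M=1$, are $$S^{ER}_{n+1/2,j}=-A_{n+1/2,j}\;S_{w_{0,0}}S^\dagger_{w_{0,1}}Z_{w_{1,-1}}S^\dagger_{w_{1,0}}S^\dagger_{w_{1,1}}S^\dagger_{g_{-1,-1}}S^\dagger_{g_{-1,0}}\,\mathrm{CZ}_{w_{0,-1},w_{0,0}}\mathrm{CZ}_{w_{1,-1},w_{1,0}}\mathrm{CZ}_{g_{0,-1},g_{1,-1}}\mathrm{CZ}_{g_{0,0},g_{1,0}},$$ or their mirror form, the image of this formula under the point reflection of the lattice about $(n+\tfrac12,j)$.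 More generally, a reduction of range $\rho$ is a family $R_{n+1/2,j}=S^E_{n+1/2,j}F_{n+1/2,j}$ of mutually commuting operators, where each $F_{n+1/2,j}$ is unitary, diagonal in the $Z$-basis, equal to $1$ on the $Z$-basis states satisfying all $S^M=1$, and depends only on the qubits in the cells $(n+d,j+e)$ with $|d|,|e|\le\rho$. Here the cell $(n,j)$ consists of the white qubit at $(n,j)$ and the black qubit at $(n+\tfrac12,j+\tfrac12)$. Let $\rho\ge 2$, and let $O$ be a local operator: it acts only on the qubits of a rectangle of $a\times b$ cells ($a$ layers, $b$ columns) with $a+2\rho<N_2$ and $b+2\rho<N_1$. Claim. Let $R$ be one of the following families: the stabilizers $S^E$; the reduced stabilizers $S^{ER}$; their mirror form; or any reduction of range $\rho$. If $O$ commutes with all $R_{n+1/2,j}$ and all $S^M_{n,j+1/2}$, then $O$ is generated by these stabilizers, i.e. $O$ is a complex linear combination of products of the operators $R_{n+1/2,j}$ and $S^M_{n,j+1/2}$. -/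

import Mathlib

/-!
The double-semion bulk model on an `N₂ × N₁` torus: layers `n ∈ ZMod N₂`, columns `j ∈ ZMod N₁`.
-/

namespace DoubleSemion

/-- The `2 N₁ N₂` qubits. `inl (n, j)` is the white (matter) qubit at position `(n, j)`;
`inr (n, j)` is the black (gauge) qubit at position `(n + 1/2, j + 1/2)`. -/
abbrev Site (N₁ N₂ : ℕ) : Type := (ZMod N₂ × ZMod N₁) ⊕ (ZMod N₂ × ZMod N₁)

/-- Labels of the `Z`-basis: the value `0` is the eigenvalue `+1` of Pauli-`Z`, the value `1` is
the eigenvalue `-1`. -/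
abbrev Config (N₁ N₂ : ℕ) : Type := Site N₁ N₂ → ZMod 2

/-- Operators on the Hilbert space of all qubits, as matrices in the `Z`-basis. -/
abbrev Op (N₁ N₂ : ℕ) : Type := Matrix (Config N₁ N₂) (Config N₁ N₂) ℂ

variable {N₁ N₂ : ℕ} [NeZero N₁] [NeZero N₂]

/-- The white qubit at `(n, j)`. -/
def wh (n : ZMod N₂) (j : ZMod N₁) : Site N₁ N₂ := Sum.inl (n, j)

/-- The black qubit at `(n + 1/2, j + 1/2)`. -/
def bl (n : ZMod N₂) (j : ZMod N₁) : Site N₁ N₂ := Sum.inr (n, j)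

/-- The cell `(n, j)` to which a qubit belongs: it holds the white qubit at `(n, j)` and the black
qubit at `(n + 1/2, j + 1/2)`. -/
def cell (s : Site N₁ N₂) : ZMod N₂ × ZMod N₁ := Sum.elim id id s

/-- Pauli-`X` on the qubit `s`. -/
noncomputable def PX (s : Site N₁ N₂) : Op N₁ N₂ :=
  Matrix.of fun c' c => if c' = c + Pi.single s 1 then 1 else 0

/-- Pauli-`Z` on the qubit `s`. -/
noncomputable def PZ (s : Site N₁ N₂) : Op N₁ N₂ :=
  Matrix.diagonal fun c => (-1 : ℂ) ^ (c s).val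

/-- The phase gate `diag(1, i)` on the qubit `s`. -/
noncomputable def Sg (s : Site N₁ N₂) : Op N₁ N₂ :=
  Matrix.diagonal fun c => Complex.I ^ (c s).val

/-- The inverse phase gate `diag(1, -i)` on the qubit `s`. -/
noncomputable def Sdg (s : Site N₁ N₂) : Op N₁ N₂ :=
  Matrix.diagonal fun c => (-Complex.I) ^ (c s).val

/-- The controlled-`Z` gate on the qubits `s` and `t`. -/
noncomputable def CZ (s t : Site N₁ N₂) : Op N₁ N₂ :=
  Matrix.diagonal fun c => (-1 : ℂ) ^ ((c s).val * (c t).val)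

/-- The product of the four Pauli-`X` around `(n + 1/2, j)`. -/
noncomputable def starX (n : ZMod N₂) (j : ZMod N₁) : Op N₁ N₂ :=
  PX (wh n j) * PX (wh (n + 1) j) * PX (bl n (j - 1)) * PX (bl n j)

/-- The stabilizer `S^M` centred at `(n, j + 1/2)`. -/
noncomputable def SM (n : ZMod N₂) (j : ZMod N₁) : Op N₁ N₂ :=
  PZ (wh n j) * PZ (wh n (j + 1)) * PZ (bl (n - 1) j) * PZ (bl n j)

/-- The (unreduced) stabilizer `S^E` centred at `(n + 1/2, j)`: the Gauss law operator of the
gauging of `U_n U_{n+1}` in its final form, after the gauging of all the higher layers. -/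
noncomputable def SE (n : ZMod N₂) (j : ZMod N₁) : Op N₁ N₂ :=
  -(starX n j
    * (Sdg (wh n (j - 1)) * Sdg (wh n j) * PZ (wh n (j + 1)))
    * (PZ (wh (n + 1) (j - 1)) * Sdg (wh (n + 1) j) * Sdg (wh (n + 1) (j + 1)))
    * (Sdg (bl n (j - 1)) * Sdg (bl n j))
    -- bonds between the white qubits of the layers `n` and `n + 1`
    * (CZ (wh n j) (wh n (j + 1)) * CZ (wh (n + 1) (j - 1)) (wh (n + 1) j)
      * CZ (wh n (j - 1)) (wh (n + 1) (j - 1)) * CZ (wh n (j + 1)) (wh (n + 1) (j + 1))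
      * CZ (wh n (j - 1)) (wh (n + 1) j) * CZ (wh n j) (wh (n + 1) (j + 1))
      * CZ (wh n j) (wh (n + 1) (j - 1)) * CZ (wh n (j + 1)) (wh (n + 1) j))
    -- bonds at the black qubit `(n + 3/2, j - 1/2)`
    * (CZ (bl (n + 1) (j - 1)) (wh n (j - 1)) * CZ (bl (n + 1) (j - 1)) (wh n j)
      * CZ (bl (n + 1) (j - 1)) (wh (n + 1) (j - 1)) * CZ (bl (n + 1) (j - 1)) (wh (n + 1) j)
      * CZ (bl (n + 1) (j - 1)) (wh (n + 2) (j - 1)) * CZ (bl (n + 1) (j - 1)) (wh (n + 2) j)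
      * CZ (bl (n + 1) (j - 1)) (bl (n + 2) (j - 1)))
    -- bonds at the black qubit `(n + 3/2, j + 1/2)`
    * (CZ (bl (n + 1) j) (wh n j) * CZ (bl (n + 1) j) (wh n (j + 1))
      * CZ (bl (n + 1) j) (wh (n + 1) j) * CZ (bl (n + 1) j) (wh (n + 1) (j + 1))
      * CZ (bl (n + 1) j) (wh (n + 2) j) * CZ (bl (n + 1) j) (wh (n + 2) (j + 1))
      * CZ (bl (n + 1) j) (bl (n + 2) j)))

/-- The reduced stabilizer `S^ER` centred at `(n + 1/2, j)`. -/
noncomputable def SER (n : ZMod N₂) (j : ZMod N₁) : Op N₁ N₂ :=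
  -(starX n j
    * (Sg (wh n j) * Sdg (wh n (j + 1)))
    * (PZ (wh (n + 1) (j - 1)) * Sdg (wh (n + 1) j) * Sdg (wh (n + 1) (j + 1)))
    * (Sdg (bl (n - 1) (j - 1)) * Sdg (bl (n - 1) j))
    * (CZ (wh n (j - 1)) (wh n j) * CZ (wh (n + 1) (j - 1)) (wh (n + 1) j)
      * CZ (bl n (j - 1)) (bl (n + 1) (j - 1)) * CZ (bl n j) (bl (n + 1) j)))

/-- The mirror form of the reduced stabilizer centred at `(n + 1/2, j)`: the image of `SER` under
the point reflection about `(n + 1/2, j)`, which preserves `SE` and permutes the `SM`. -/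
noncomputable def SERmirror (n : ZMod N₂) (j : ZMod N₁) : Op N₁ N₂ :=
  -(starX n j
    * (Sg (wh (n + 1) j) * Sdg (wh (n + 1) (j - 1)))
    * (PZ (wh n (j + 1)) * Sdg (wh n j) * Sdg (wh n (j - 1)))
    * (Sdg (bl (n + 1) (j - 1)) * Sdg (bl (n + 1) j))
    * (CZ (wh (n + 1) j) (wh (n + 1) (j + 1)) * CZ (wh n j) (wh n (j + 1))
      * CZ (bl (n - 1) (j - 1)) (bl n (j - 1)) * CZ (bl (n - 1) j) (bl n j)))

/-- The `Z`-basis state labelled by `c` satisfies all the stabilizers `S^M` (which are diagonal). -/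
def FluxFree (c : Config N₁ N₂) : Prop :=
  ∀ (n : ZMod N₂) (j : ZMod N₁), SM n j c c = 1

/-- The qubits in the cells within distance `ρ` (in each direction) of the cell `(n, j)`. -/
def window (ρ : ℕ) (n : ZMod N₂) (j : ZMod N₁) : Set (Site N₁ N₂) :=
  {s | ∃ d e : ℤ, |d| ≤ ρ ∧ |e| ≤ ρ ∧ cell s = (n + (d : ZMod N₂), j + (e : ZMod N₁))}

/-- `R` is a form of the model with reduced stabilizers, of range `ρ`: each `R n j` is obtained
from `SE n j` by a modification of its diagonal factor by local phases that are trivial where all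
`S^M = 1`, and the `R n j` commute with each other. -/
def IsReduction (ρ : ℕ) (R : ZMod N₂ → ZMod N₁ → Op N₁ N₂) : Prop :=
  (∃ f : ZMod N₂ → ZMod N₁ → Config N₁ N₂ → ℂ,
    (∀ n j, R n j = SE n j * Matrix.diagonal (f n j)) ∧
    (∀ n j c, ‖f n j c‖ = 1) ∧
    (∀ n j c, FluxFree c → f n j c = 1) ∧
    (∀ n j c d, (∀ s ∈ window ρ n j, c s = d s) → f n j c = f n j d)) ∧
  (∀ n j n' j', Commute (R n j) (R n' j'))

/-- The algebra of operators generated by a family of stabilizers together with all the `S^M`. -/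
noncomputable def stabilizerAlgebra (R : ZMod N₂ → ZMod N₁ → Op N₁ N₂) :
    Subalgebra ℂ (Op N₁ N₂) :=
  Algebra.adjoin ℂ ({T | ∃ n j, T = R n j} ∪ {T | ∃ n j, T = SM n j})

/-- `O` acts only on the qubits in `Λ`, that is `O = O_Λ ⊗ 1`. -/
def SupportedOn (Λ : Set (Site N₁ N₂)) (O : Op N₁ N₂) : Prop :=
  (∀ c' c, (∃ s, s ∉ Λ ∧ c' s ≠ c s) → O c' c = 0) ∧
  (∀ c' c d' d, (∀ s ∈ Λ, c' s = d' s ∧ c s = d s) →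
    (∀ s, s ∉ Λ → c' s = c s ∧ d' s = d s) → O c' c = O d' d)

/-- The qubits in the rectangle of `a × b` cells (layers times columns) with corner `(n₀, j₀)`. -/
def box (n₀ : ZMod N₂) (j₀ : ZMod N₁) (a b : ℕ) : Set (Site N₁ N₂) :=
  {s | ∃ k l : ℕ, k < a ∧ l < b ∧ cell s = (n₀ + (k : ZMod N₂), j₀ + (l : ZMod N₁))}

/-- `O` is local: it is supported in a rectangle which, enlarged by `ρ` cells on every side, still
does not wrap around the torus in either direction. -/
def IsLocal (ρ : ℕ) (O : Op N₁ N₂) : Prop :=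
  ∃ (n₀ : ZMod N₂) (j₀ : ZMod N₁) (a b : ℕ),
    a + 2 * ρ < N₂ ∧ b + 2 * ρ < N₁ ∧ SupportedOn (box n₀ j₀ a b) O

end DoubleSemion

namespace DoubleSemion

open Finset

set_option linter.unusedSectionVars false

variable {N₁ N₂ : ℕ} [NeZero N₁] [NeZero N₂]

/-! ### Cochains on the torus -/

/-! Sort the matrix entries of `O` by the configuration `v` that they flip. Commuting with every
`SM` forces each `v` that occurs to be flux-free, and locality confines it to a rectangle that does
not wrap around the torus. There a closed cochain is exact, so `v` is a sum of stars centred in the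
rectangle (`exists_sum_star_eq`). The product of the corresponding `R` flips the same `v` with a
nowhere vanishing phase `ψ`, and lies in the algebra. What remains is a diagonal factor `h`.

Since both `O` and the product commute with all `R`, `h` is invariant under every star, and `h` sees
only the rectangle enlarged by `ρ`. Two configurations with equal fluxes differ on that rectangle by
a sum of stars (`exists_sum_star_eqOn`), so `h` is a function of the fluxes and hence a polynomial
in the `SM` (`diagonal_mem_stabilizerAlgebra`).

The argument needs the `R` to commute with each other. For a reduction this is assumed; for the
three explicit families it becomes a finite list of identities over `ZMod 4`. -/

/-- The qubits flipped by the star operator centred at `(n + 1/2, j)`. -/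
def star (p : ZMod N₂ × ZMod N₁) : Config N₁ N₂ :=
  Pi.single (wh p.1 p.2) 1 + Pi.single (wh (p.1 + 1) p.2) 1
    + Pi.single (bl p.1 (p.2 - 1)) 1 + Pi.single (bl p.1 p.2) 1

/-- The flux at `(n, j + 1/2)`. -/
def flux (c : Config N₁ N₂) (n : ZMod N₂) (j : ZMod N₁) : ZMod 2 :=
  c (wh n j) + c (wh n (j + 1)) + c (bl (n - 1) j) + c (bl n j)

theorem flux_add (c d : Config N₁ N₂) (n : ZMod N₂) (j : ZMod N₁) :
    flux (c + d) n j = flux c n j + flux d n j := by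
  simp only [flux, Pi.add_apply]; ring

theorem star_wh (p : ZMod N₂ × ZMod N₁) (n : ZMod N₂) (j : ZMod N₁) :
    star p (wh n j) = (if p = (n, j) then 1 else 0) + (if p = (n - 1, j) then 1 else 0) := by
  obtain ⟨a, b⟩ := p
  have h : n = a + 1 ↔ a = n - 1 := by rw [eq_sub_iff_add_eq, eq_comm]
  simp [star, wh, bl, Pi.single_apply, h, eq_comm]

theorem star_bl (p : ZMod N₂ × ZMod N₁) (n : ZMod N₂) (j : ZMod N₁) :
    star p (bl n j) = (if p = (n, j) then 1 else 0) + (if p = (n, j + 1) then 1 else 0) := by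
  obtain ⟨a, b⟩ := p
  simp [star, wh, bl, Pi.single_apply, eq_comm, eq_sub_iff_add_eq, add_comm]

theorem sum_star_wh (E : Finset (ZMod N₂ × ZMod N₁)) (n : ZMod N₂) (j : ZMod N₁) :
    (∑ p ∈ E, star p) (wh n j)
      = (if (n, j) ∈ E then 1 else 0) + (if (n - 1, j) ∈ E then 1 else 0) := by
  simp [Finset.sum_apply, star_wh, Finset.sum_add_distrib]

theorem sum_star_bl (E : Finset (ZMod N₂ × ZMod N₁)) (n : ZMod N₂) (j : ZMod N₁) :
    (∑ p ∈ E, star p) (bl n j)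
      = (if (n, j) ∈ E then 1 else 0) + (if (n, j + 1) ∈ E then 1 else 0) := by
  simp [Finset.sum_apply, star_bl, Finset.sum_add_distrib]

theorem zmod_two_add_self (x : ZMod 2) : x + x = 0 := CharTwo.add_self_eq_zero x

theorem zmod_two_eq_of_add {x y : ZMod 2} (h : x + y = 0) : x = y := CharTwo.add_eq_zero.mp h

theorem ite_eq_one (x : ZMod 2) : (if x = 1 then 1 else 0) = x := by
  revert x; decide

theorem val_eq_val_sub_one_add_one {N : ℕ} [NeZero N] {a : ZMod N} (h : a ≠ 0) :
    a.val = (a - 1).val + 1 := by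
  have hN : 1 < N := by
    by_contra hN
    have : N = 1 := by have := NeZero.pos N; omega
    subst this
    exact h (Subsingleton.elim _ _)
  have h1 : (1 : ZMod N).val = 1 := by
    have : Fact (1 < N) := ⟨hN⟩
    exact ZMod.val_one N
  have h0 : a.val ≠ 0 := by simpa [ZMod.val_eq_zero] using h
  have := ZMod.val_sub (a := a) (b := 1) (by omega)
  omega

theorem cast_val_add {N : ℕ} [NeZero N] (m n : ZMod N) : n + (((m - n).val : ℕ) : ZMod N) = m := by
  simp

theorem mem_box_iff {n₀ : ZMod N₂} {j₀ : ZMod N₁} {a b : ℕ} (ha : a ≤ N₂) (hb : b ≤ N₁)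
    (s : Site N₁ N₂) :
    s ∈ box n₀ j₀ a b ↔ ((cell s).1 - n₀).val < a ∧ ((cell s).2 - j₀).val < b := by
  constructor
  · rintro ⟨k, l, hk, hl, h⟩
    rw [h]
    simp only [add_sub_cancel_left]
    rw [ZMod.val_cast_of_lt (by omega), ZMod.val_cast_of_lt (by omega)]
    exact ⟨hk, hl⟩
  · rintro ⟨hk, hl⟩
    exact ⟨_, _, hk, hl, by rw [cast_val_add, cast_val_add]⟩

/-- A flux-free configuration is a sum of stars on any rectangle that does not wrap around the
torus. -/
theorem exists_sum_star_eqOn {v : Config N₁ N₂} (hv : ∀ n j, flux v n j = 0)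
    (n₀ : ZMod N₂) (j₀ : ZMod N₁) {a b : ℕ} (ha : a < N₂) (hb : b < N₁) :
    ∃ E : Finset (ZMod N₂ × ZMod N₁), ∀ s ∈ box n₀ j₀ a b, (∑ p ∈ E, star p) s = v s := by
  -- A potential for `v`: its sum along the path from `(n₀ - 1, j₀)` through the white qubits of
  -- column `j₀`, then along the black qubits of row `p.1`. The base lies one row below the box
  -- because the white qubits of row `n₀` compare `x` on rows `n₀ - 1` and `n₀`.
  let x : ZMod N₂ × ZMod N₁ → ZMod 2 := fun p =>
    ∑ k ∈ range (p.1 - (n₀ - 1)).val, v (wh (n₀ + k) j₀)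
      + ∑ l ∈ range (p.2 - j₀).val, v (bl p.1 (j₀ + l))
  refine ⟨univ.filter fun p => x p = 1, ?_⟩
  -- Stokes on a strip: the vanishing fluxes of row `n` add up to a relation along its boundary.
  have tel : ∀ (n : ZMod N₂) (m : ℕ),
      ∑ l ∈ range m, v (bl n (j₀ + l)) + ∑ l ∈ range m, v (bl (n - 1) (j₀ + l))
        = v (wh n j₀) + v (wh n (j₀ + m)) := by
    intro n m
    induction m with
    | zero => simp [zmod_two_add_self]
    | succ m ih =>
      rw [sum_range_succ, sum_range_succ]
      have h := hv n (j₀ + m)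
      simp only [flux] at h
      rw [show j₀ + ((m + 1 : ℕ) : ZMod N₁) = j₀ + m + 1 by push_cast; ring]
      grind
  rintro s hs
  rw [mem_box_iff ha.le hb.le] at hs
  rcases s with ⟨n, j⟩ | ⟨n, j⟩
  · change (∑ p ∈ _, star p) (wh n j) = v (wh n j)
    simp only [cell, Sum.elim_inl, id] at hs
    rw [sum_star_wh]
    simp only [mem_filter, mem_univ, true_and, ite_eq_one, x]
    have h1 : (n - (n₀ - 1)).val = (n - n₀).val + 1 := by
      rw [val_eq_val_sub_one_add_one (a := n - (n₀ - 1))]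
      · congr 2; ring
      · intro h
        have h2 : n - n₀ = -1 := by linear_combination h
        have h3 : (((n - n₀).val + 1 : ℕ) : ZMod N₂) = 0 := by
          push_cast; rw [ZMod.natCast_zmod_val, h2]; ring
        rw [ZMod.natCast_eq_zero_iff] at h3
        have := Nat.le_of_dvd (by omega) h3
        omega
    have h2 : n - 1 - (n₀ - 1) = n - n₀ := by ring
    have h3 := tel n (j - j₀).val
    rw [h1, h2, sum_range_succ]
    rw [cast_val_add] at h3 ⊢
    grind
  · change (∑ p ∈ _, star p) (bl n j) = v (bl n j)
    simp only [cell, Sum.elim_inr, id] at hs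
    rw [sum_star_bl]
    simp only [mem_filter, mem_univ, true_and, ite_eq_one, x]
    have h1 : (j + 1 - j₀).val = (j - j₀).val + 1 := by
      rw [val_eq_val_sub_one_add_one (a := j + 1 - j₀)]
      · congr 2; ring
      · intro h
        have h2 : j - j₀ = -1 := by linear_combination h
        have h3 : (((j - j₀).val + 1 : ℕ) : ZMod N₁) = 0 := by
          push_cast; rw [ZMod.natCast_zmod_val, h2]; ring
        rw [ZMod.natCast_eq_zero_iff] at h3
        have := Nat.le_of_dvd (by omega) h3
        omega
    rw [h1, sum_range_succ, cast_val_add]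
    grind

/-- A flux-free configuration supported in a rectangle that does not wrap around the torus is the
sum of stars centred in the rectangle. -/
theorem exists_sum_star_eq {v : Config N₁ N₂} (hv : ∀ n j, flux v n j = 0)
    {n₀ : ZMod N₂} {j₀ : ZMod N₁} {a b : ℕ} (ha : a < N₂) (hb : b < N₁)
    (hbox : ∀ s, s ∉ box n₀ j₀ a b → v s = 0) :
    ∃ E : Finset (ZMod N₂ × ZMod N₁), ∑ p ∈ E, star p = v ∧
      ∀ p ∈ E, (p.1 - n₀).val < a ∧ (p.2 - j₀).val < b := by
  have hw : ∀ n j, ¬ ((n - n₀).val < a ∧ (j - j₀).val < b) → v (wh n j) = 0 := fun n j h =>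
    hbox _ (by rw [mem_box_iff ha.le hb.le]; exact h)
  have hbl : ∀ n j, ¬ ((n - n₀).val < a ∧ (j - j₀).val < b) → v (bl n j) = 0 := fun n j h =>
    hbox _ (by rw [mem_box_iff ha.le hb.le]; exact h)
  -- Here the potential is a sum up a single column, started at the bottom row of the box, so that
  -- it can be shown to vanish outside the box.
  let y : ℕ → ZMod N₁ → ZMod 2 := fun m j => ∑ k ∈ range m, v (wh (n₀ + k) j)
  have tel : ∀ (m : ℕ) (j : ZMod N₁),
      y m j + y m (j + 1) = v (bl (n₀ - 1) j) + v (bl (n₀ + m - 1) j) := by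
    intro m j
    induction m with
    | zero => simp [y, zmod_two_add_self]
    | succ m ih =>
      have h := hv (n₀ + m) j
      simp only [flux] at h
      simp only [y, sum_range_succ] at ih ⊢
      have e : n₀ + ((m + 1 : ℕ) : ZMod N₂) - 1 = n₀ + m := by push_cast; ring
      rw [e]
      grind
  have lastRow : ∀ j, v (bl (n₀ - 1) j) = 0 := by
    intro j
    apply hbl
    rintro ⟨h, -⟩
    have h3 : (((n₀ - 1 - n₀ : ZMod N₂).val + 1 : ℕ) : ZMod N₂) = 0 := by
      push_cast; rw [ZMod.natCast_zmod_val]; ring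
    rw [ZMod.natCast_eq_zero_iff] at h3
    have := Nat.le_of_dvd (by omega) h3
    omega
  -- No monodromy around a column: the full column sum does not depend on `j`, and column `j₀ - 1`
  -- misses the box.
  have total : ∀ j, y N₂ j = 0 := by
    have step : ∀ j, y N₂ (j + 1) = y N₂ j := by
      intro j
      have := tel N₂ j
      rw [ZMod.natCast_self, add_zero, zmod_two_add_self] at this
      exact (zmod_two_eq_of_add this).symm
    have hall : ∀ l : ℕ, y N₂ (j₀ - 1 + l) = y N₂ (j₀ - 1) := by
      intro l
      induction l with
      | zero => simp
      | succ l ih => rw [Nat.cast_succ, ← add_assoc, step, ih]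
    intro j
    rw [← cast_val_add j (j₀ - 1), hall]
    refine sum_eq_zero fun k _ => hw _ _ ?_
    rintro ⟨-, h⟩
    have h3 : (((j₀ - 1 - j₀ : ZMod N₁).val + 1 : ℕ) : ZMod N₁) = 0 := by
      push_cast; rw [ZMod.natCast_zmod_val]; ring
    rw [ZMod.natCast_eq_zero_iff] at h3
    have := Nat.le_of_dvd (by omega) h3
    omega
  let x : ZMod N₂ × ZMod N₁ → ZMod 2 := fun p => y ((p.1 - n₀).val + 1) p.2
  refine ⟨univ.filter fun p => x p = 1, ?_, ?_⟩
  · funext s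
    rcases s with ⟨n, j⟩ | ⟨n, j⟩
    · change (∑ p ∈ _, star p) (wh n j) = v (wh n j)
      rw [sum_star_wh]
      simp only [mem_filter, mem_univ, true_and, ite_eq_one, x]
      have e1 : y ((n - n₀).val + 1) j = y (n - n₀).val j + v (wh n j) := by
        simp only [y]; rw [sum_range_succ, cast_val_add]
      have e2 : y ((n - 1 - n₀).val + 1) j = y (n - n₀).val j := by
        by_cases h : n - n₀ = 0
        · have e : n - 1 - n₀ = ((N₂ - 1 : ℕ) : ZMod N₂) := by
            rw [Nat.cast_sub (NeZero.one_le), ZMod.natCast_self, Nat.cast_one]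
            linear_combination h
          rw [e, ZMod.val_cast_of_lt (by omega), Nat.sub_add_cancel NeZero.one_le, total, h]
          simp [y]
        · rw [val_eq_val_sub_one_add_one h]
          congr 3; ring
      rw [e1, e2]
      grind
    · change (∑ p ∈ _, star p) (bl n j) = v (bl n j)
      rw [sum_star_bl]
      simp only [mem_filter, mem_univ, true_and, ite_eq_one, x]
      rw [tel, lastRow, zero_add]
      congr 2
      push_cast
      rw [ZMod.natCast_zmod_val]; ring
  · rintro ⟨n, j⟩ hp
    simp only [mem_filter, mem_univ, true_and, x] at hp
    by_contra hcon
    have hz : y ((n - n₀).val + 1) j = 0 := by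
      by_cases hj : (j - j₀).val < b
      -- Past the last row of the box, the partial column sum already equals the full one, which is
      -- zero.
      · rw [← total j]
        have hle : (n - n₀).val + 1 ≤ N₂ := ZMod.val_lt _
        refine sum_subset (range_mono hle) fun k hk hk' => hw _ _ ?_
        rintro ⟨h, -⟩
        rw [add_sub_cancel_left, ZMod.val_cast_of_lt (mem_range.mp hk)] at h
        simp only [mem_range] at hk'
        exact hcon ⟨by simp only; omega, hj⟩
      · exact sum_eq_zero fun k _ => hw _ _ fun h => hj h.2
    rw [hz] at hp
    exact zero_ne_one hp

/-! ### Shift operators with phases -/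

/-- The operator sending the basis state `c` to `φ c` times the basis state `c + v`. -/
noncomputable def mono (v : Config N₁ N₂) (φ : Config N₁ N₂ → ℂ) : Op N₁ N₂ :=
  Matrix.of fun c' c => if c' = c + v then φ c else 0

theorem mono_apply (v : Config N₁ N₂) (φ : Config N₁ N₂ → ℂ) (c' c : Config N₁ N₂) :
    mono v φ c' c = if c' = c + v then φ c else 0 := rfl

theorem mono_mul_mono (v w : Config N₁ N₂) (φ ψ : Config N₁ N₂ → ℂ) :
    mono v φ * mono w ψ = mono (v + w) fun c => φ (c + w) * ψ c := by
  ext c' c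
  rw [Matrix.mul_apply, sum_eq_single (c + w)]
  · simp only [mono_apply, if_true, add_assoc, add_comm w v]
    split_ifs <;> simp
  · intro d _ hd
    simp [mono_apply, hd]
  · simp

theorem mono_zero (φ : Config N₁ N₂ → ℂ) : mono 0 φ = Matrix.diagonal φ := by
  ext c' c
  simp only [mono_apply, add_zero, Matrix.diagonal_apply]
  split_ifs with h
  · rw [h]
  · rfl

theorem mono_mul_diagonal (v : Config N₁ N₂) (φ ψ : Config N₁ N₂ → ℂ) :
    mono v φ * Matrix.diagonal ψ = mono v fun c => φ c * ψ c := by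
  rw [← mono_zero, mono_mul_mono]; simp

theorem neg_mono (v : Config N₁ N₂) (φ : Config N₁ N₂ → ℂ) :
    -mono v φ = mono v fun c => -φ c := by
  ext c' c
  simp only [Matrix.neg_apply, mono_apply]
  split_ifs <;> simp

theorem mono_inj {v : Config N₁ N₂} {φ ψ : Config N₁ N₂ → ℂ} (h : mono v φ = mono v ψ) :
    φ = ψ := by
  funext c
  simpa [mono_apply] using congrFun (congrFun h (c + v)) c

theorem commute_mono_iff (v w : Config N₁ N₂) (φ ψ : Config N₁ N₂ → ℂ) :
    Commute (mono v φ) (mono w ψ) ↔ ∀ c, φ (c + w) * ψ c = ψ (c + v) * φ c := by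
  rw [Commute, SemiconjBy, mono_mul_mono, mono_mul_mono, add_comm w v]
  exact ⟨fun h => congrFun (mono_inj h), fun h => by rw [funext h]⟩

/-- Splits a matrix by the difference of its row and column labels, so that each shift can be
treated separately. -/
theorem sum_mono (O : Op N₁ N₂) : O = ∑ v, mono v fun c => O (c + v) c := by
  ext c' c
  rw [Matrix.sum_apply, sum_eq_single (c' - c)]
  · simp [mono_apply]
  · intro v _ hv
    rw [mono_apply, if_neg]
    rintro rfl
    exact hv (by simp)
  · simp

theorem zmod_two_eq_zero_or_one (x : ZMod 2) : x = 0 ∨ x = 1 := by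
  revert x; decide

theorem zmod_two_val_one : (1 : ZMod 2).val = 1 := rfl

theorem neg_one_pow_val_add (x y : ZMod 2) :
    (-1 : ℂ) ^ (x + y).val = (-1) ^ x.val * (-1) ^ y.val := by
  rcases zmod_two_eq_zero_or_one x with rfl | rfl <;>
    rcases zmod_two_eq_zero_or_one y with rfl | rfl <;>
    simp [zmod_two_val_one, CharTwo.add_self_eq_zero]

theorem one_add_neg_one_pow_val (x y : ZMod 2) :
    (1 + (-1 : ℂ) ^ x.val * (-1) ^ y.val) / 2 = if x = y then 1 else 0 := by
  rcases zmod_two_eq_zero_or_one x with rfl | rfl <;>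
    rcases zmod_two_eq_zero_or_one y with rfl | rfl <;>
    simp [zmod_two_val_one]

theorem neg_one_pow_val_inj {x y : ZMod 2} (h : (-1 : ℂ) ^ x.val = (-1) ^ y.val) : x = y := by
  rcases zmod_two_eq_zero_or_one x with rfl | rfl <;>
    rcases zmod_two_eq_zero_or_one y with rfl | rfl <;>
    first | rfl | (norm_num [zmod_two_val_one] at h)

/-! ### The algebra generated by the stabilizers -/

theorem SM_eq (n : ZMod N₂) (j : ZMod N₁) :
    SM n j = Matrix.diagonal fun c : Config N₁ N₂ => (-1 : ℂ) ^ (flux c n j).val := by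
  simp only [SM, PZ, Matrix.diagonal_mul_diagonal, flux, neg_one_pow_val_add]

/-- A function of the fluxes is a polynomial in the `S^M`. -/
theorem diagonal_mem_stabilizerAlgebra (R : ZMod N₂ → ZMod N₁ → Op N₁ N₂)
    (h : Config N₁ N₂ → ℂ) (hflux : ∀ c d, flux c = flux d → h c = h d) :
    Matrix.diagonal h ∈ stabilizerAlgebra R := by
  classical
  let S : Subalgebra ℂ (Config N₁ N₂ → ℂ) :=
    (stabilizerAlgebra R).comap (Matrix.diagonalAlgHom ℂ)
  have hSM : ∀ n j, (fun c : Config N₁ N₂ => (-1 : ℂ) ^ (flux c n j).val) ∈ S := by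
    intro n j
    change Matrix.diagonal _ ∈ stabilizerAlgebra R
    rw [← SM_eq]
    exact Algebra.subset_adjoin (Or.inr ⟨n, j, rfl⟩)
  -- The projector onto a flux sector is a product of factors `(1 ± SM) / 2`.
  have hind : ∀ d : Config N₁ N₂,
      (fun c : Config N₁ N₂ => if flux c = flux d then (1 : ℂ) else 0) ∈ S := by
    intro d
    have : (fun c : Config N₁ N₂ => if flux c = flux d then (1 : ℂ) else 0)
        = ∏ p : ZMod N₂ × ZMod N₁, ((2⁻¹ : ℂ) • (1 + ((-1 : ℂ) ^ (flux d p.1 p.2).val) •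
          fun c : Config N₁ N₂ => (-1 : ℂ) ^ (flux c p.1 p.2).val)) := by
      funext c
      have e : ∀ p : ZMod N₂ × ZMod N₁, (2⁻¹ : ℂ) * (1 + (-1 : ℂ) ^ (flux d p.1 p.2).val *
          (-1 : ℂ) ^ (flux c p.1 p.2).val) = if flux c p.1 p.2 = flux d p.1 p.2 then 1 else 0 := by
        intro p
        rw [← one_add_neg_one_pow_val]; ring
      simp only [Finset.prod_apply, Pi.smul_apply, Pi.add_apply, Pi.one_apply, smul_eq_mul, e,
        prod_boole]
      congr 1
      simp [funext_iff]
    rw [this]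
    exact Subalgebra.prod_mem _ fun p _ =>
      Subalgebra.smul_mem _ (add_mem (one_mem _) (Subalgebra.smul_mem _ (hSM _ _) _)) _
  -- Summing over all configurations counts each flux sector `N d` times; dividing by `N d` avoids a
  -- choice of representatives.
  let N : Config N₁ N₂ → ℂ := fun d => #{c | flux c = flux d}
  have hN : ∀ d, N d ≠ 0 := by
    intro d
    simp only [N, ne_eq, Nat.cast_eq_zero, card_eq_zero]
    exact Finset.Nonempty.ne_empty ⟨d, by simp⟩
  have : h = ∑ d, (h d / N d) • fun c : Config N₁ N₂ => if flux c = flux d then (1 : ℂ) else 0 := by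
    funext c
    simp only [Finset.sum_apply, Pi.smul_apply, smul_eq_mul, mul_ite, mul_one, mul_zero]
    rw [← sum_filter]
    have : ∀ d ∈ univ.filter (fun d => flux c = flux d), h d / N d = h c / N c := by
      intro d hd
      simp only [mem_filter, mem_univ, true_and] at hd
      rw [hflux c d hd]
      simp only [N, hd]
    rw [sum_congr rfl this, sum_const, nsmul_eq_mul]
    simp only [eq_comm (a := flux c)]
    exact (mul_div_cancel₀ _ (hN c)).symm
  change h ∈ S
  rw [this]
  exact sum_mem fun d _ => Subalgebra.smul_mem _ (hind d) _

/-- Products of the stabilizers of a commuting family. -/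
theorem exists_mono_sum_star {R : ZMod N₂ → ZMod N₁ → Op N₁ N₂}
    {φ : ZMod N₂ × ZMod N₁ → Config N₁ N₂ → ℂ} (hR : ∀ p, R p.1 p.2 = mono (star p) (φ p))
    (hφ : ∀ p c, φ p c ≠ 0) (hcomm : ∀ p q : ZMod N₂ × ZMod N₁, Commute (R p.1 p.2) (R q.1 q.2))
    (Λ : Set (Site N₁ N₂)) (E : Finset (ZMod N₂ × ZMod N₁))
    (hΛ : ∀ p ∈ E, ∀ c d, (∀ s ∈ Λ, c s = d s) → φ p c = φ p d) :
    ∃ ψ : Config N₁ N₂ → ℂ, mono (∑ p ∈ E, star p) ψ ∈ stabilizerAlgebra R ∧ (∀ c, ψ c ≠ 0) ∧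
      (∀ q : ZMod N₂ × ZMod N₁, Commute (mono (∑ p ∈ E, star p) ψ) (R q.1 q.2)) ∧
      ∀ c d, (∀ s ∈ Λ, c s = d s) → ψ c = ψ d := by
  classical
  induction E using Finset.induction_on with
  | empty =>
    refine ⟨1, ?_, by simp, ?_, by simp⟩
    · rw [sum_empty, mono_zero, Pi.one_def, Matrix.diagonal_one]; exact one_mem _
    · intro q
      rw [sum_empty, mono_zero, Pi.one_def, Matrix.diagonal_one]; exact Commute.one_left _
  | insert p E hp ih =>
    obtain ⟨ψ, h1, h2, h3, h4⟩ := ih fun p hp => hΛ p (mem_insert_of_mem hp)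
    refine ⟨fun c => φ p (c + ∑ q ∈ E, star q) * ψ c, ?_, ?_, ?_, ?_⟩
    · rw [sum_insert hp, ← mono_mul_mono, ← hR]
      exact mul_mem (Algebra.subset_adjoin (Or.inl ⟨p.1, p.2, rfl⟩)) h1
    · exact fun c => mul_ne_zero (hφ _ _) (h2 _)
    · intro q
      rw [sum_insert hp, ← mono_mul_mono, ← hR]
      exact (hcomm p q).mul_left (h3 q)
    · intro c d hcd
      simp only
      rw [h4 c d hcd, hΛ p (mem_insert_self _ _) (c + _) (d + _)]
      intro s hs
      simp [hcd s hs]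

theorem box_subset_box (ρ : ℕ) (n₀ : ZMod N₂) (j₀ : ZMod N₁) (a b : ℕ) :
    box n₀ j₀ a b ⊆ box (n₀ - ρ) (j₀ - ρ) (a + 2 * ρ) (b + 2 * ρ) := by
  rintro s ⟨k, l, hk, hl, h⟩
  refine ⟨k + ρ, l + ρ, by omega, by omega, ?_⟩
  rw [h]; push_cast
  ext <;> simp only <;> ring

theorem window_subset_box (ρ : ℕ) {n₀ : ZMod N₂} {j₀ : ZMod N₁} {a b : ℕ}
    {p : ZMod N₂ × ZMod N₁} (h1 : (p.1 - n₀).val < a) (h2 : (p.2 - j₀).val < b) :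
    window ρ p.1 p.2 ⊆ box (n₀ - ρ) (j₀ - ρ) (a + 2 * ρ) (b + 2 * ρ) := by
  rintro s ⟨d, e, hd, he, h⟩
  rw [abs_le] at hd he
  obtain ⟨d', hd'⟩ := Int.eq_ofNat_of_zero_le (a := d + ρ) (by omega)
  obtain ⟨e', he'⟩ := Int.eq_ofNat_of_zero_le (a := e + ρ) (by omega)
  obtain rfl : d = d' - ρ := by omega
  obtain rfl : e = e' - ρ := by omega
  refine ⟨(p.1 - n₀).val + d', (p.2 - j₀).val + e', by omega, by omega, ?_⟩
  rw [h]; push_cast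
  rw [ZMod.natCast_zmod_val, ZMod.natCast_zmod_val]
  ext <;> simp only <;> ring

/-- The common core of all four cases: of the phases it uses only that they are nonzero, local and
make the `R` commute. -/
theorem mem_stabilizerAlgebra_of_commute {ρ : ℕ} {O : Op N₁ N₂} (hloc : IsLocal ρ O)
    (hM : ∀ (n : ZMod N₂) (j : ZMod N₁), Commute O (SM n j))
    {R : ZMod N₂ → ZMod N₁ → Op N₁ N₂} {φ : ZMod N₂ × ZMod N₁ → Config N₁ N₂ → ℂ}
    (hR : ∀ p, R p.1 p.2 = mono (star p) (φ p)) (hφ : ∀ p c, φ p c ≠ 0)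
    (hwin : ∀ (p : ZMod N₂ × ZMod N₁) c d, (∀ s ∈ window ρ p.1 p.2, c s = d s) → φ p c = φ p d)
    (hcomm : ∀ p q : ZMod N₂ × ZMod N₁, Commute (R p.1 p.2) (R q.1 q.2))
    (hO : ∀ (n : ZMod N₂) (j : ZMod N₁), Commute O (R n j)) : O ∈ stabilizerAlgebra R := by
  obtain ⟨n₀, j₀, a, b, ha, hb, hsupp, hsupp'⟩ := hloc
  rw [sum_mono O]
  refine sum_mem fun v _ => ?_
  by_cases hzero : ∀ c, O (c + v) c = 0
  · convert zero_mem (stabilizerAlgebra R)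
    ext c' c
    simp [mono_apply, hzero]
  push Not at hzero
  obtain ⟨c₀, hc₀⟩ := hzero
  have hvbox : ∀ s, s ∉ box n₀ j₀ a b → v s = 0 := by
    intro s hs
    by_contra hv
    exact hc₀ (hsupp _ _ ⟨s, hs, by simpa using hv⟩)
  have hvflux : ∀ n j, flux v n j = 0 := by
    intro n j
    have h := congrFun (congrFun (hM n j) (c₀ + v)) c₀
    rw [SM_eq, Matrix.mul_diagonal, Matrix.diagonal_mul, mul_comm] at h
    have := neg_one_pow_val_inj (mul_right_cancel₀ hc₀ h)
    rw [flux_add] at this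
    simpa using this
  obtain ⟨E, rfl, hE⟩ := exists_sum_star_eq hvflux (by omega) (by omega) hvbox
  set v := ∑ p ∈ E, star p with hv
  set Λ := box (n₀ - (ρ : ZMod N₂)) (j₀ - (ρ : ZMod N₁)) (a + 2 * ρ) (b + 2 * ρ) with hΛ
  obtain ⟨ψ, hψ, hψ0, hψR, hψΛ⟩ := exists_mono_sum_star hR hφ hcomm Λ E
    fun p hp c d hcd => hwin p c d fun s hs =>
      hcd s (window_subset_box ρ (hE p hp).1 (hE p hp).2 hs)
  rw [← hv] at hψ hψR
  let h : Config N₁ N₂ → ℂ := fun c => O (c + v) c / ψ c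
  have hmul : (mono v fun c => O (c + v) c) = mono v ψ * Matrix.diagonal h := by
    rw [mono_mul_diagonal]
    congr 1
    funext c
    exact (mul_div_cancel₀ _ (hψ0 c)).symm
  rw [hmul]
  refine mul_mem hψ (diagonal_mem_stabilizerAlgebra R h ?_)
  -- The entry of `O * R = R * O` from `c` to `c + star p + v` gives for `O (c + v) c` the same
  -- transformation law as for `ψ c`, so the quotient is invariant.
  have hstar : ∀ p c, h (c + star p) = h c := by
    intro p c
    have e1 := congrFun (congrFun (hO p.1 p.2) (c + star p + v)) c
    rw [hR, Matrix.mul_apply, Matrix.mul_apply, sum_eq_single (c + star p),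
      sum_eq_single (c + v)] at e1
    · have e2 := hψR p
      rw [hR, commute_mono_iff] at e2
      have e2 := e2 c
      simp only [mono_apply, if_true, if_pos (add_right_comm c (star p) v)] at e1
      simp only [h]
      rw [div_eq_div_iff (hψ0 _) (hψ0 _)]
      refine mul_right_cancel₀ (hφ p c) ?_
      linear_combination ψ c * e1 - O (c + v) c * e2
    · intro d _ hd
      rw [mono_apply, if_neg, zero_mul]
      rw [add_right_comm]
      exact fun h => hd (add_right_cancel h).symm
    · simp
    · intro d _ hd
      rw [mono_apply, if_neg hd, mul_zero]
    · simp
  have hsum : ∀ (F : Finset (ZMod N₂ × ZMod N₁)) c, h (c + ∑ p ∈ F, star p) = h c := by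
    classical
    intro F
    induction F using Finset.induction_on with
    | empty => simp
    | insert p F hp ih =>
      intro c
      rw [sum_insert hp, ← add_assoc, ih, hstar]
  have hloc : ∀ c d, (∀ s ∈ Λ, c s = d s) → h c = h d := by
    intro c d hcd
    simp only [h]
    rw [hψΛ c d hcd, hsupp' (c + v) c (d + v) d]
    · intro s hs
      have := hcd s (box_subset_box ρ n₀ j₀ a b hs)
      simp [this]
    · intro s hs
      simp [hvbox s hs]
  intro c d hcd
  have hf : ∀ n j, flux (c + d) n j = 0 := by
    intro n j
    rw [flux_add, hcd, zmod_two_add_self]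
  -- Globally `c + d` may have noncontractible loops and be no sum of stars; agreement on `Λ`
  -- suffices because `h` sees only `Λ`.
  obtain ⟨F, hF⟩ := exists_sum_star_eqOn hf (n₀ - (ρ : ZMod N₂)) (j₀ - (ρ : ZMod N₁)) ha hb
  rw [← hsum F c]
  refine hloc _ _ fun s hs => ?_
  rw [Pi.add_apply, hF s hs, Pi.add_apply, ← add_assoc, zmod_two_add_self, zero_add]

/-! ### Phases -/

/-- The character `x ↦ i ^ x` of `ZMod 4`. -/
noncomputable def phase (x : ZMod 4) : ℂ := Complex.I ^ x.val

/-- The bit `0` or `1` as an element of `ZMod 4`. -/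
def bit (x : ZMod 2) : ZMod 4 := (x.val : ZMod 4)

theorem phase_add (x y : ZMod 4) : phase (x + y) = phase x * phase y := by
  rw [phase, phase, phase, ← pow_add, ZMod.val_add, ← Complex.I_pow_eq_pow_mod]

theorem norm_phase (x : ZMod 4) : ‖phase x‖ = 1 := by simp [phase]

/-- A flip becomes an affine map over `ZMod 4`, which makes commutation of phases a polynomial
identity. -/
theorem bit_add_one (x : ZMod 2) : bit (x + 1) = 1 - bit x := by revert x; decide

theorem neg_one_pow_val (x : ZMod 2) : (-1 : ℂ) ^ x.val = phase (2 * bit x) := by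
  have h : (2 : ZMod 4).val = 2 := rfl
  rcases zmod_two_eq_zero_or_one x with rfl | rfl <;> simp [phase, bit, zmod_two_val_one, h]

theorem I_pow_val (x : ZMod 2) : Complex.I ^ x.val = phase (bit x) := by
  rcases zmod_two_eq_zero_or_one x with rfl | rfl <;> rfl

theorem neg_I_pow_val (x : ZMod 2) : (-Complex.I) ^ x.val = phase (-bit x) := by
  have h : (-1 : ZMod 4).val = 3 := rfl
  rcases zmod_two_eq_zero_or_one x with rfl | rfl <;>
    simp [phase, bit, zmod_two_val_one, h, Complex.I_pow_three]

theorem neg_one_pow_val_mul (x y : ZMod 2) :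
    (-1 : ℂ) ^ (x.val * y.val) = phase (2 * (bit x * bit y)) := by
  rcases zmod_two_eq_zero_or_one x with rfl | rfl
  · simp [bit, phase]
  · rw [zmod_two_val_one, one_mul, neg_one_pow_val]; simp [bit, zmod_two_val_one]

/-- The white qubits in coordinates centred at `p`. -/
def whiteAt (c : Config N₁ N₂) (p : ZMod N₂ × ZMod N₁) (k l : ℤ) : ZMod 4 :=
  bit (c (wh (p.1 + k) (p.2 + l)))

/-- The black qubits in coordinates centred at `p`. -/
def blackAt (c : Config N₁ N₂) (p : ZMod N₂ × ZMod N₁) (k l : ℤ) : ZMod 4 :=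
  bit (c (bl (p.1 + k) (p.2 + l)))

/-- The action on the white qubits of the star centred at `(Δ + 1/2, δ)`. -/
def flipWhite (Δ δ : ℤ) (w : ℤ → ℤ → ZMod 4) (k l : ℤ) : ZMod 4 :=
  if l = δ ∧ (k = Δ ∨ k = Δ + 1) then 1 - w k l else w k l

/-- The action on the black qubits of the star centred at `(Δ + 1/2, δ)`. -/
def flipBlack (Δ δ : ℤ) (g : ℤ → ℤ → ZMod 4) (k l : ℤ) : ZMod 4 :=
  if k = Δ ∧ (l = δ ∨ l + 1 = δ) then 1 - g k l else g k l

/-! ### Commutation on the torus from commutation on the integer lattice -/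

theorem intCast_inj_of_abs_lt {N : ℕ} {k l : ℤ} (h1 : k - l < N) (h2 : l - k < N) :
    (k : ZMod N) = l ↔ k = l := by
  refine ⟨fun h => ?_, fun h => by rw [h]⟩
  rw [ZMod.intCast_eq_intCast_iff_dvd_sub] at h
  have := Int.eq_zero_of_abs_lt_dvd h (by rw [abs_lt]; constructor <;> linarith)
  linarith

/-- Offsets up to 4 arise from a separation of at most 2 plus the reach of a phase, so size 5
excludes wrap-around. The row bounds are asymmetric because `k` is compared with both `Δ` and `Δ +
1`. -/
theorem whiteAt_add_star (hN₁ : 5 ≤ N₁) (hN₂ : 5 ≤ N₂) (c : Config N₁ N₂)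
    (p : ZMod N₂ × ZMod N₁) {Δ δ k l : ℤ} (hk : -3 ≤ k - Δ) (hk' : k - Δ ≤ 4)
    (hl : -4 ≤ l - δ) (hl' : l - δ ≤ 4) :
    whiteAt (c + star (p.1 + (Δ : ZMod N₂), p.2 + (δ : ZMod N₁))) p k l =
      flipWhite Δ δ (whiteAt c p) k l := by
  have e1 : (Δ : ZMod N₂) = k ↔ k = Δ := by
    rw [intCast_inj_of_abs_lt (by omega) (by omega), eq_comm]
  have e2 : (Δ : ZMod N₂) = k - 1 ↔ k = Δ + 1 := by
    rw [← Int.cast_one, ← Int.cast_sub, intCast_inj_of_abs_lt (by omega) (by omega)]; omega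
  have e3 : (δ : ZMod N₁) = l ↔ l = δ := by
    rw [intCast_inj_of_abs_lt (by omega) (by omega), eq_comm]
  simp only [whiteAt, flipWhite, Pi.add_apply, star_wh, Prod.mk.injEq, add_sub_assoc,
    add_right_inj, e1, e2, e3]
  by_cases h1 : l = δ <;> by_cases h2 : k = Δ <;> by_cases h3 : k = Δ + 1
  · omega
  all_goals simp [h1, h2, h3, bit_add_one]

theorem blackAt_add_star (hN₁ : 5 ≤ N₁) (hN₂ : 5 ≤ N₂) (c : Config N₁ N₂)
    (p : ZMod N₂ × ZMod N₁) {Δ δ k l : ℤ} (hk : -4 ≤ k - Δ) (hk' : k - Δ ≤ 4)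
    (hl : -4 ≤ l - δ) (hl' : l - δ ≤ 3) :
    blackAt (c + star (p.1 + (Δ : ZMod N₂), p.2 + (δ : ZMod N₁))) p k l =
      flipBlack Δ δ (blackAt c p) k l := by
  have e1 : (Δ : ZMod N₂) = k ↔ k = Δ := by
    rw [intCast_inj_of_abs_lt (by omega) (by omega), eq_comm]
  have e2 : (δ : ZMod N₁) = l + 1 ↔ l + 1 = δ := by
    rw [← Int.cast_one, ← Int.cast_add, intCast_inj_of_abs_lt (by omega) (by omega), eq_comm]
  have e3 : (δ : ZMod N₁) = l ↔ l = δ := by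
    rw [intCast_inj_of_abs_lt (by omega) (by omega), eq_comm]
  simp only [blackAt, flipBlack, Pi.add_apply, star_bl, Prod.mk.injEq, add_assoc,
    add_right_inj, e1, e2, e3]
  by_cases h1 : k = Δ <;> by_cases h2 : l = δ <;> by_cases h3 : l + 1 = δ
  · omega
  all_goals simp [h1, h2, h3, bit_add_one]

/-- `Q` depends only on the qubits near the origin. -/
def IsNear (Q : (ℤ → ℤ → ZMod 4) → (ℤ → ℤ → ZMod 4) → ZMod 4) : Prop :=
  ∀ w g w' g' : ℤ → ℤ → ZMod 4,
    (∀ k l, -1 ≤ k → k ≤ 2 → -1 ≤ l → l ≤ 1 → w k l = w' k l) →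
    (∀ k l, -2 ≤ k → k ≤ 2 → -1 ≤ l → l ≤ 0 → g k l = g' k l) → Q w g = Q w' g'

/-- The star operators with phases `Q` centred at the origin and at `(Δ, δ)` commute. -/
def CommutesAt (Q : (ℤ → ℤ → ZMod 4) → (ℤ → ℤ → ZMod 4) → ZMod 4) (Δ δ : ℤ) : Prop :=
  ∀ w g : ℤ → ℤ → ZMod 4,
    Q (flipWhite Δ δ w) (flipBlack Δ δ g)
      + Q (fun k l => w (Δ + k) (δ + l)) (fun k l => g (Δ + k) (δ + l))
    = Q (fun k l => flipWhite 0 0 w (Δ + k) (δ + l)) (fun k l => flipBlack 0 0 g (Δ + k) (δ + l))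
      + Q w g

/-- The phase `Q` centred at `p`. -/
noncomputable def phaseAt (Q : (ℤ → ℤ → ZMod 4) → (ℤ → ℤ → ZMod 4) → ZMod 4)
    (p : ZMod N₂ × ZMod N₁) (c : Config N₁ N₂) : ℂ :=
  -phase (Q (whiteAt c p) (blackAt c p))

theorem phaseAt_ne_zero (Q : (ℤ → ℤ → ZMod 4) → (ℤ → ℤ → ZMod 4) → ZMod 4)
    (p : ZMod N₂ × ZMod N₁) (c : Config N₁ N₂) : phaseAt Q p c ≠ 0 := by
  rw [phaseAt, ne_eq, neg_eq_zero, ← norm_eq_zero, norm_phase]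
  exact one_ne_zero

variable {Q : (ℤ → ℤ → ZMod 4) → (ℤ → ℤ → ZMod 4) → ZMod 4}

theorem phaseAt_congr (hQ : IsNear Q) {ρ : ℕ} (hρ : 2 ≤ ρ) (p : ZMod N₂ × ZMod N₁)
    {c d : Config N₁ N₂} (h : ∀ s ∈ window ρ p.1 p.2, c s = d s) :
    phaseAt Q p c = phaseAt Q p d := by
  rw [phaseAt, phaseAt, hQ _ _ (whiteAt d p) (blackAt d p)]
  · intro k l hk hk' hl hl'
    rw [whiteAt, whiteAt, h]
    exact ⟨k, l, by rw [abs_le]; omega, by rw [abs_le]; omega, rfl⟩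
  · intro k l hk hk' hl hl'
    rw [blackAt, blackAt, h]
    exact ⟨k, l, by rw [abs_le]; omega, by rw [abs_le]; omega, rfl⟩

theorem commute_of_phase_eq {p q : ZMod N₂ × ZMod N₁}
    (h : ∀ c : Config N₁ N₂,
      Q (whiteAt (c + star q) p) (blackAt (c + star q) p) + Q (whiteAt c q) (blackAt c q)
      = Q (whiteAt (c + star p) q) (blackAt (c + star p) q) + Q (whiteAt c p) (blackAt c p)) :
    Commute (mono (star p) (phaseAt Q p)) (mono (star q) (phaseAt Q q)) := by
  rw [commute_mono_iff]
  intro c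
  simp only [phaseAt, neg_mul_neg, ← phase_add, h]

theorem commute_of_commutesAt (hN₁ : 5 ≤ N₁) (hN₂ : 5 ≤ N₂) (hQ : IsNear Q)
    {Δ δ : ℤ} (hΔ : -2 ≤ Δ) (hΔ' : Δ ≤ 2) (hδ : -1 ≤ δ) (hδ' : δ ≤ 1) (h : CommutesAt Q Δ δ)
    (p : ZMod N₂ × ZMod N₁) :
    Commute (mono (star p) (phaseAt Q p))
      (mono (star (p.1 + (Δ : ZMod N₂), p.2 + (δ : ZMod N₁)))
        (phaseAt Q (p.1 + (Δ : ZMod N₂), p.2 + (δ : ZMod N₁)))) := by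
  refine commute_of_phase_eq fun c => ?_
  have hw : ∀ c : Config N₁ N₂, whiteAt c (p.1 + (Δ : ZMod N₂), p.2 + (δ : ZMod N₁))
      = fun k l => whiteAt c p (Δ + k) (δ + l) := by
    intro c; funext k l; simp [whiteAt, add_assoc]
  have hb : ∀ c : Config N₁ N₂, blackAt c (p.1 + (Δ : ZMod N₂), p.2 + (δ : ZMod N₁))
      = fun k l => blackAt c p (Δ + k) (δ + l) := by
    intro c; funext k l; simp [blackAt, add_assoc]
  have hp : star p = star (p.1 + ((0 : ℤ) : ZMod N₂), p.2 + ((0 : ℤ) : ZMod N₁)) := by simp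
  have e₁ := hQ (whiteAt (c + star (p.1 + (Δ : ZMod N₂), p.2 + (δ : ZMod N₁))) p)
    (blackAt (c + star (p.1 + (Δ : ZMod N₂), p.2 + (δ : ZMod N₁))) p)
    (flipWhite Δ δ (whiteAt c p)) (flipBlack Δ δ (blackAt c p))
    (fun k l _ _ _ _ =>
      whiteAt_add_star hN₁ hN₂ c p (by omega) (by omega) (by omega) (by omega))
    (fun k l _ _ _ _ =>
      blackAt_add_star hN₁ hN₂ c p (by omega) (by omega) (by omega) (by omega))
  have e₂ := hQ (fun k l => whiteAt (c + star p) p (Δ + k) (δ + l))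
    (fun k l => blackAt (c + star p) p (Δ + k) (δ + l))
    (fun k l => flipWhite 0 0 (whiteAt c p) (Δ + k) (δ + l))
    (fun k l => flipBlack 0 0 (blackAt c p) (Δ + k) (δ + l))
    (fun k l _ _ _ _ => by
      have := whiteAt_add_star hN₁ hN₂ c p (Δ := 0) (δ := 0) (k := Δ + k) (l := δ + l)
        (by omega) (by omega) (by omega) (by omega)
      rwa [← hp] at this)
    (fun k l _ _ _ _ => by
      have := blackAt_add_star hN₁ hN₂ c p (Δ := 0) (δ := 0) (k := Δ + k) (l := δ + l)
        (by omega) (by omega) (by omega) (by omega)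
      rwa [← hp] at this)
  rw [hw, hb, hw, hb, e₁, e₂]
  exact h (whiteAt c p) (blackAt c p)

/-- The stars that touch the qubits allowed by `IsNear` are exactly those at separations `|k| ≤ 2`,
`|l| ≤ 1`. -/
theorem phase_add_star_of_far (hQ : IsNear Q) {p q : ZMod N₂ × ZMod N₁}
    (h : ∀ k l : ℤ, -2 ≤ k → k ≤ 2 → -1 ≤ l → l ≤ 1 → q ≠ (p.1 + (k : ZMod N₂), p.2 + (l : ZMod N₁)))
    (c : Config N₁ N₂) :
    Q (whiteAt (c + star q) p) (blackAt (c + star q) p) = Q (whiteAt c p) (blackAt c p) := by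
  apply hQ
  · intro k l _ _ _ _
    have h2 := h (k - 1) l (by omega) (by omega) (by omega) (by omega)
    rw [Int.cast_sub, Int.cast_one, ← add_sub_assoc] at h2
    simp [whiteAt, star_wh, h k l (by omega) (by omega) (by omega) (by omega), h2]
  · intro k l _ _ _ _
    have h2 := h k (l + 1) (by omega) (by omega) (by omega) (by omega)
    rw [Int.cast_add, Int.cast_one, ← add_assoc] at h2
    simp [blackAt, star_bl, h k l (by omega) (by omega) (by omega) (by omega), h2]

/-- A family of star operators with phases commutes if it does so at small separations. -/
theorem commute_of_forall_commutesAt (hN₁ : 5 ≤ N₁) (hN₂ : 5 ≤ N₂) (hQ : IsNear Q)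
    (h₀ : CommutesAt Q 0 1)
    (h₁ : ∀ Δ δ : ℤ, 1 ≤ Δ → Δ ≤ 2 → -1 ≤ δ → δ ≤ 1 → CommutesAt Q Δ δ)
    (p q : ZMod N₂ × ZMod N₁) :
    Commute (mono (star p) (phaseAt Q p)) (mono (star q) (phaseAt Q q)) := by
  by_cases hfar : ∃ k l : ℤ, -2 ≤ k ∧ k ≤ 2 ∧ -1 ≤ l ∧ l ≤ 1 ∧
      q = (p.1 + (k : ZMod N₂), p.2 + (l : ZMod N₁))
  · obtain ⟨k, l, hk, hk', hl, hl', rfl⟩ := hfar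
    -- Half of the separations is enough: exchanging the two centres negates `(k, l)`.
    have key : ∀ (k l : ℤ) (p : ZMod N₂ × ZMod N₁), -2 ≤ k → k ≤ 2 → -1 ≤ l → l ≤ 1 →
        (1 ≤ k ∨ k = 0 ∧ l = 1) → Commute (mono (star p) (phaseAt Q p))
          (mono (star (p.1 + (k : ZMod N₂), p.2 + (l : ZMod N₁)))
            (phaseAt Q (p.1 + (k : ZMod N₂), p.2 + (l : ZMod N₁)))) := by
      intro k l p hk hk' hl hl' h
      refine commute_of_commutesAt hN₁ hN₂ hQ hk hk' hl hl' ?_ p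
      rcases h with h | ⟨rfl, rfl⟩
      · exact h₁ k l h hk' hl hl'
      · exact h₀
    by_cases hpos : 1 ≤ k ∨ k = 0 ∧ l = 1
    · exact key k l p hk hk' hl hl' hpos
    by_cases hzero : k = 0 ∧ l = 0
    · obtain ⟨rfl, rfl⟩ := hzero
      simp
    · have := key (-k) (-l) (p.1 + (k : ZMod N₂), p.2 + (l : ZMod N₁)) (by omega) (by omega)
        (by omega) (by omega) (by omega)
      simpa using this.symm
  · refine commute_of_phase_eq fun c => ?_
    rw [phase_add_star_of_far hQ, phase_add_star_of_far hQ, add_comm]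
    · rintro k l hk hk' hl hl' rfl
      exact hfar ⟨-k, -l, by omega, by omega, by omega, by omega, by simp⟩
    · rintro k l hk hk' hl hl' rfl
      exact hfar ⟨k, l, by omega, by omega, by omega, by omega, rfl⟩

/-! ### The three explicit families -/

theorem PX_eq_mono (s : Site N₁ N₂) : PX s = mono (Pi.single s 1) fun _ => 1 := rfl

theorem starX_eq_mono (n : ZMod N₂) (j : ZMod N₁) :
    starX n j = mono (star (n, j)) fun _ => 1 := by
  simp [starX, PX_eq_mono, mono_mul_mono, star]

/-- The exponent of `i` in the phases of `SE`. -/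
def phaseSE (w g : ℤ → ℤ → ZMod 4) : ZMod 4 :=
  (-w 0 (-1) + -w 0 0 + 2 * w 0 1) + (2 * w 1 (-1) + -w 1 0 + -w 1 1) + (-g 0 (-1) + -g 0 0)
    + (2 * (w 0 0 * w 0 1) + 2 * (w 1 (-1) * w 1 0) + 2 * (w 0 (-1) * w 1 (-1))
      + 2 * (w 0 1 * w 1 1) + 2 * (w 0 (-1) * w 1 0) + 2 * (w 0 0 * w 1 1)
      + 2 * (w 0 0 * w 1 (-1)) + 2 * (w 0 1 * w 1 0))
    + (2 * (g 1 (-1) * w 0 (-1)) + 2 * (g 1 (-1) * w 0 0) + 2 * (g 1 (-1) * w 1 (-1))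
      + 2 * (g 1 (-1) * w 1 0) + 2 * (g 1 (-1) * w 2 (-1)) + 2 * (g 1 (-1) * w 2 0)
      + 2 * (g 1 (-1) * g 2 (-1)))
    + (2 * (g 1 0 * w 0 0) + 2 * (g 1 0 * w 0 1) + 2 * (g 1 0 * w 1 0) + 2 * (g 1 0 * w 1 1)
      + 2 * (g 1 0 * w 2 0) + 2 * (g 1 0 * w 2 1) + 2 * (g 1 0 * g 2 0))

/-- The exponent of `i` in the phases of `SER`. -/
def phaseSER (w g : ℤ → ℤ → ZMod 4) : ZMod 4 :=
  (w 0 0 + -w 0 1) + (2 * w 1 (-1) + -w 1 0 + -w 1 1) + (-g (-1) (-1) + -g (-1) 0)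
    + (2 * (w 0 (-1) * w 0 0) + 2 * (w 1 (-1) * w 1 0) + 2 * (g 0 (-1) * g 1 (-1))
      + 2 * (g 0 0 * g 1 0))

/-- The exponent of `i` in the phases of `SERmirror`. -/
def phaseSERmirror (w g : ℤ → ℤ → ZMod 4) : ZMod 4 :=
  (w 1 0 + -w 1 (-1)) + (2 * w 0 1 + -w 0 0 + -w 0 (-1)) + (-g 1 (-1) + -g 1 0)
    + (2 * (w 1 0 * w 1 1) + 2 * (w 0 0 * w 0 1) + 2 * (g (-1) (-1) * g 0 (-1))
      + 2 * (g (-1) 0 * g 0 0))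

theorem SE_eq_mono (p : ZMod N₂ × ZMod N₁) :
    SE p.1 p.2 = mono (star p) (phaseAt phaseSE p) := by
  simp only [SE, starX_eq_mono, Sdg, PZ, CZ, Matrix.diagonal_mul_diagonal, mono_mul_diagonal,
    neg_mono, neg_I_pow_val, neg_one_pow_val, neg_one_pow_val_mul, one_mul, ← phase_add]
  congr 1
  funext c
  simp [phaseAt, phaseSE, whiteAt, blackAt, sub_eq_add_neg]

theorem SER_eq_mono (p : ZMod N₂ × ZMod N₁) :
    SER p.1 p.2 = mono (star p) (phaseAt phaseSER p) := by
  simp only [SER, starX_eq_mono, Sg, Sdg, PZ, CZ, Matrix.diagonal_mul_diagonal, mono_mul_diagonal,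
    neg_mono, I_pow_val, neg_I_pow_val, neg_one_pow_val, neg_one_pow_val_mul, one_mul, ← phase_add]
  congr 1
  funext c
  simp [phaseAt, phaseSER, whiteAt, blackAt, sub_eq_add_neg]

theorem SERmirror_eq_mono (p : ZMod N₂ × ZMod N₁) :
    SERmirror p.1 p.2 = mono (star p) (phaseAt phaseSERmirror p) := by
  simp only [SERmirror, starX_eq_mono, Sg, Sdg, PZ, CZ, Matrix.diagonal_mul_diagonal,
    mono_mul_diagonal, neg_mono, I_pow_val, neg_I_pow_val, neg_one_pow_val, neg_one_pow_val_mul,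
    one_mul, ← phase_add]
  congr 1
  funext c
  simp [phaseAt, phaseSERmirror, whiteAt, blackAt, sub_eq_add_neg]

theorem isNear_phaseSE : IsNear phaseSE := by
  intro w g w' g' hw hg
  simp [phaseSE, hw, hg]

theorem isNear_phaseSER : IsNear phaseSER := by
  intro w g w' g' hw hg
  simp [phaseSER, hw, hg]

theorem isNear_phaseSERmirror : IsNear phaseSERmirror := by
  intro w g w' g' hw hg
  simp [phaseSERmirror, hw, hg]

/-- This and the similar checks below hold for arbitrary values in `ZMod 4`, not only for bits. -/
theorem commutesAt_phaseSE_zero : CommutesAt phaseSE 0 1 := by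
  intro w g
  norm_num [phaseSE, flipWhite, flipBlack]
  grind

theorem commutesAt_phaseSE {Δ δ : ℤ} (hΔ : 1 ≤ Δ) (hΔ' : Δ ≤ 2) (hδ : -1 ≤ δ) (hδ' : δ ≤ 1) :
    CommutesAt phaseSE Δ δ := by
  intro w g
  interval_cases Δ <;> interval_cases δ <;> norm_num [phaseSE, flipWhite, flipBlack] <;> grind

theorem commutesAt_phaseSER_zero : CommutesAt phaseSER 0 1 := by
  intro w g
  norm_num [phaseSER, flipWhite, flipBlack]
  grind

theorem commutesAt_phaseSER {Δ δ : ℤ} (hΔ : 1 ≤ Δ) (hΔ' : Δ ≤ 2) (hδ : -1 ≤ δ) (hδ' : δ ≤ 1) :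
    CommutesAt phaseSER Δ δ := by
  intro w g
  interval_cases Δ <;> interval_cases δ <;> norm_num [phaseSER, flipWhite, flipBlack] <;> grind

theorem commutesAt_phaseSERmirror_zero : CommutesAt phaseSERmirror 0 1 := by
  intro w g
  norm_num [phaseSERmirror, flipWhite, flipBlack]
  grind

theorem commutesAt_phaseSERmirror {Δ δ : ℤ} (hΔ : 1 ≤ Δ) (hΔ' : Δ ≤ 2) (hδ : -1 ≤ δ)
    (hδ' : δ ≤ 1) : CommutesAt phaseSERmirror Δ δ := by
  intro w g
  interval_cases Δ <;> interval_cases δ <;> norm_num [phaseSERmirror, flipWhite, flipBlack] <;>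
    grind

theorem mem_stabilizerAlgebra_of_phaseAt {ρ : ℕ} (hρ : 2 ≤ ρ) {O : Op N₁ N₂} (hloc : IsLocal ρ O)
    (hM : ∀ (n : ZMod N₂) (j : ZMod N₁), Commute O (SM n j))
    {R : ZMod N₂ → ZMod N₁ → Op N₁ N₂} (hR : ∀ p, R p.1 p.2 = mono (star p) (phaseAt Q p))
    (hQ : IsNear Q) (h₀ : CommutesAt Q 0 1)
    (h₁ : ∀ Δ δ : ℤ, 1 ≤ Δ → Δ ≤ 2 → -1 ≤ δ → δ ≤ 1 → CommutesAt Q Δ δ)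
    (hO : ∀ (n : ZMod N₂) (j : ZMod N₁), Commute O (R n j)) : O ∈ stabilizerAlgebra R := by
  refine mem_stabilizerAlgebra_of_commute hloc hM hR (phaseAt_ne_zero Q)
    (fun p c d h => phaseAt_congr hQ hρ p h) (fun p q => ?_) hO
  obtain ⟨n₀, j₀, a, b, ha, hb, -⟩ := hloc
  rw [hR, hR]
  -- Both sizes are at least 5, from `a + 2 * ρ < N₂`, `b + 2 * ρ < N₁` and `2 ≤ ρ`.
  exact commute_of_forall_commutesAt (by omega) (by omega) hQ h₀ h₁ p q

end DoubleSemion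

open DoubleSemion

theorem mainTheorem3 (N₁ N₂ : ℕ) [NeZero N₁] [NeZero N₂] (ρ : ℕ) (hρ : 2 ≤ ρ)
    (O : Op N₁ N₂) (hloc : IsLocal ρ O)
    (hM : ∀ (n : ZMod N₂) (j : ZMod N₁), Commute O (SM n j)) :
    ((∀ (n : ZMod N₂) (j : ZMod N₁), Commute O (SE n j)) → O ∈ stabilizerAlgebra SE) ∧
    ((∀ (n : ZMod N₂) (j : ZMod N₁), Commute O (SER n j)) → O ∈ stabilizerAlgebra SER) ∧
    ((∀ (n : ZMod N₂) (j : ZMod N₁), Commute O (SERmirror n j)) →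
      O ∈ stabilizerAlgebra SERmirror) ∧
    (∀ R : ZMod N₂ → ZMod N₁ → Op N₁ N₂, IsReduction ρ R →
      (∀ (n : ZMod N₂) (j : ZMod N₁), Commute O (R n j)) → O ∈ stabilizerAlgebra R) := by
  refine ⟨fun hO => ?_, fun hO => ?_, fun hO => ?_, ?_⟩
  · exact mem_stabilizerAlgebra_of_phaseAt hρ hloc hM SE_eq_mono isNear_phaseSE
      commutesAt_phaseSE_zero (fun _ _ => commutesAt_phaseSE) hO
  · exact mem_stabilizerAlgebra_of_phaseAt hρ hloc hM SER_eq_mono isNear_phaseSER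
      commutesAt_phaseSER_zero (fun _ _ => commutesAt_phaseSER) hO
  · exact mem_stabilizerAlgebra_of_phaseAt hρ hloc hM SERmirror_eq_mono isNear_phaseSERmirror
      commutesAt_phaseSERmirror_zero (fun _ _ => commutesAt_phaseSERmirror) hO
  · rintro R ⟨⟨f, hRf, hnorm, -, hwin⟩, hcomm⟩ hO
    -- A reduction only multiplies the phase of `SE` by a local factor of modulus one, so the core
    -- argument applies.
    refine mem_stabilizerAlgebra_of_commute (φ := fun p c => phaseAt phaseSE p c * f p.1 p.2 c)
      hloc hM (fun p => ?_) (fun p c => ?_) (fun p c d h => ?_) (fun p q => hcomm _ _ _ _) hO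
    · rw [hRf, SE_eq_mono, mono_mul_diagonal]
    · refine mul_ne_zero (phaseAt_ne_zero _ _ _) ?_
      rw [← norm_ne_zero_iff, hnorm]
      exact one_ne_zero
    · rw [phaseAt_congr isNear_phaseSE hρ p h, hwin p.1 p.2 c d h]
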